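/- Let $r\ge s\ge 1$ be integers and order subsets of $\mathbb Z\times\mathbb Z$ componentwise. Put $$R_{r,s}=[r]\times[s],\quad RT_{r,s}=\{(i,j)\in[r+s-1]\times[s] : i-j<r\},\quad T_{r,s}=\{(i,j)\in RT_{r,s} : i+j>s\}.$$ For $1\le k\le s$ let $I_k\subseteq RT_{r,s}$ be the union of $T_{r,k}$ and of $\{(i,j)\in RT_{r,s} : k\le i\le r+k-1,\ k+1\le j\le s\}$, so that $I_s=T_{r,s}$ and $I_1=R_{r,s}$. A *polygonal* chain of $I_k$ is a maximal chain of the poset $I_k$ that contains $(k,1)$ or meets the left border $L=\{(\ell+r-1,\ell) : 1\le\ell\le s\}$; let $\mathscr P_k$ be the set of all of them. For a finite poset $P$ and $x\in\mathbb R_{+}^{P}$ (labels are positive real numbers), the weight of a subset $C\subseteq P$ is $w_C(x)=\prod_{p\in C}x_p$, and $w_{\mathscr C}(x)=\sum_{C\in\mathscr C}w_C(x)$ for a collection $\mathscr C$ of subsets. For $p\in P$ the toggle $\tau_p:\mathbb R_+^P\to\mathbb R_+^P$ replaces $x_p$ by $\bigl(\sum_{C\ni p}w_C(x)\bigr)^{-1}$,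 the sum being over all maximal chains $C$ of $P$ containing $p$, and keeps all other labels; it is an involution. Antichain rowmotion is the bijection $\tilde\rho_P=\tau_{p_n}\circ\cdots\circ\tau_{p_1}$ of $\mathbb R_+^P$, where $p_1,\dots,p_n$ is any linear extension of $P$ (the choice does not matter). For $1\le k<s$ let $M_k=\{(i,j)\in RT_{r,s} : k\le i\le r+k,\ 1\le j\le k+1\}$ and let $a_k>0$ be an arbitrary constant. Define $\zeta_k:\mathbb R_+^{I_{k+1}}\to\mathbb R_+^{I_k}$ as follows. Given $x$, let $\bar x\in\mathbb R_+^{M_k}$ agree with $x$ on $M_k\setminus\{(k,1)\}\subseteq I_{k+1}$ and have $\bar x_{k,1}=a_k$. Then for $(i,j)\in I_k$ $$\zeta_k(x)_{i,j}=\begin{cases}\tilde\rho_{M_k}^{-1}(\bar x)_{i,j}&\text{if }(i,j)\in M_k,\\ x_{i+1,j}&\text{if }(i,j)\notin M_k\text{ and }j>k+1,\\ x_{i,j+1}&\text{if }(i,j)\notin M_k\text{ and }i<k.\end{cases}$$ Let $\zeta=\zeta_1\circ\zeta_2\circ\cdots\circ\zeta_{s-1}:\mathbb R_+^{T_{r,s}}\to\mathbb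 R_+^{R_{r,s}}$. **Theorem.** Let $\mathscr C$ and $\mathscr C'$ be the sets of all maximal chains of $T_{r,s}$ and of $R_{r,s}$, respectively. 1. For all $x\in\mathbb R_+^{T_{r,s}}$, $\;w_{\mathscr C}(x)=w_{\mathscr C'}(\zeta(x))$. 2. For all $1\le k<s$ and all $x\in\mathbb R_+^{I_{k+1}}$, $\;w_{\mathscr P_{k+1}}(x)=w_{\mathscr P_k}(\zeta_k(x))$. Both hold for every choice of the constants $a_k>0$. -/

import Mathlib

namespace RectTrap

/-- The positive real numbers. -/
abbrev PosReal : Type := {a : ℝ // 0 < a}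

section Poset

variable {P : Type} [Fintype P] [PartialOrder P]

/-- The weight of a subset `C` of a finite poset under a labeling `x` by positive reals. -/
noncomputable def weight (x : P → PosReal) (C : Finset P) : ℝ := ∏ q ∈ C, (x q : ℝ)

/-- The total weight of a collection of subsets. -/
noncomputable def totalWeight (x : P → PosReal) (𝒞 : Finset (Finset P)) : ℝ :=
  ∑ C ∈ 𝒞, weight x C

variable (P) in
open scoped Classical in
/-- The set of all maximal chains of a finite poset. -/
noncomputable def maxChains : Finset (Finset P) :=
  Finset.univ.filter fun C => IsMaxChain (· ≤ ·) (C : Set P)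

open scoped Classical in
/-- The set of all maximal chains containing `p`. -/
noncomputable def maxChainsThrough (p : P) : Finset (Finset P) :=
  (maxChains P).filter fun C => p ∈ C

theorem maxChainsThrough_nonempty (p : P) : (maxChainsThrough p).Nonempty := by
  classical
  obtain ⟨M, hM, hp⟩ := 
    (IsChain.singleton (r := ((· ≤ ·) : P → P → Prop)) (a := p)).exists_maxChain
  refine ⟨M.toFinite.toFinset, ?_⟩
  simp only [maxChainsThrough, maxChains, Finset.mem_filter, Finset.mem_univ, true_and,
    Set.Finite.coe_toFinset, Set.Finite.mem_toFinset]
  exact ⟨hM, hp rfl⟩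

theorem totalWeight_through_pos (x : P → PosReal) (p : P) :
    0 < totalWeight x (maxChainsThrough p) :=
  Finset.sum_pos (fun C _ => Finset.prod_pos fun q _ => (x q).2) (maxChainsThrough_nonempty p)

open scoped Classical in
/-- The (antichain) toggle at `p` as a map: it replaces the label of `p` by the inverse of the
total weight of the maximal chains through `p`. -/
noncomputable def toggleFun (p : P) (x : P → PosReal) : P → PosReal :=
  Function.update x p
    ⟨(totalWeight x (maxChainsThrough p))⁻¹, inv_pos.2 (totalWeight_through_pos x p)⟩

theorem toggleFun_involutive (p : P) : Function.Involutive (toggleFun (P := P) p) := by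
  classical
  intro x
  set S : ℝ := ∑ C ∈ maxChainsThrough p, ∏ q ∈ C.erase p, (x q : ℝ) with hS
  have key : ∀ y : P → PosReal, (∀ q, q ≠ p → y q = x q) →
      totalWeight y (maxChainsThrough p) = y p * S := by
    intro y hy
    rw [hS, totalWeight, Finset.mul_sum]
    refine Finset.sum_congr rfl fun C hC => ?_
    have hp : p ∈ C := (Finset.mem_filter.1 hC).2
    rw [weight, ← Finset.mul_prod_erase C _ hp]
    congr 1
    refine Finset.prod_congr rfl fun q hq => ?_
    rw [hy q (Finset.ne_of_mem_erase hq)]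
  have h1 := key x fun _ _ => rfl
  have h2 := key (toggleFun p x) fun q hq => by simp [toggleFun, hq]
  have hx := (x p).2
  have hSpos : 0 < S := by
    have := totalWeight_through_pos x p
    rw [h1] at this
    exact (mul_pos_iff_of_pos_left hx).1 this
  have h3 : ((toggleFun p x p : PosReal) : ℝ) = (x p * S)⁻¹ := by
    simp [toggleFun, h1]
  funext q
  by_cases hq : q = p
  · subst hq
    apply Subtype.ext
    have : ((toggleFun q (toggleFun q x) q : PosReal) : ℝ)
        = (totalWeight (toggleFun q x) (maxChainsThrough q))⁻¹ := by
      conv_lhs => rw [toggleFun]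
      simp
    rw [this, h2, h3]
    field_simp
  · simp [toggleFun, hq]

/-- The (antichain) toggle at `p`, as a permutation of the set of positive labelings. -/
noncomputable def toggle (p : P) : Equiv.Perm (P → PosReal) :=
  (toggleFun_involutive p).toPerm

variable (P) in
/-- A linear extension: an order-preserving bijection onto an `n`-element chain. -/
abbrev LinExt : Type := {L : P ≃ Fin (Fintype.card P) // Monotone L}

instance : Nonempty (LinExt P) := by
  classical
  let _ : Fintype (LinearExtension P) := inferInstanceAs (Fintype P)
  let e := Fintype.orderIsoFinOfCardEq (LinearExtension P) (k := Fintype.card P) rfl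
  exact ⟨⟨e.symm.toEquiv, fun a b h =>
    e.symm.monotone (toLinearExtension (α := P).monotone h)⟩⟩

/-- The composition of the toggles along a linear extension, from bottom to top: the toggle of the
first element is applied first. -/
noncomputable def rowmotionAlong (L : LinExt P) : Equiv.Perm (P → PosReal) :=
  ((List.finRange (Fintype.card P)).map fun i => toggle (L.1.symm i)).reverse.prod

variable (P) in
/-- (Antichain) birational rowmotion of a finite poset. It is the composition of the toggles along
any linear extension, see `rowmotion_eq_along`. -/
noncomputable def rowmotion : Equiv.Perm (P → PosReal) :=
  rowmotionAlong (Classical.arbitrary (LinExt P))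

open scoped Classical in
theorem rowmotionAlong_spec (L : LinExt P) (x : P → PosReal) (p : P) :
    ((rowmotionAlong L x p : PosReal) : ℝ) =
      (∑ C ∈ maxChainsThrough p, ∏ q ∈ C,
        if q < p then ((rowmotionAlong L x q : PosReal) : ℝ) else (x q : ℝ))⁻¹ := by
  set n := Fintype.card P with hn
  set st : ℕ → P → PosReal := fun m =>
    (((List.finRange n).take m).map fun i => toggle (L.1.symm i)).reverse.prod x with hst
  have hfin : st n = rowmotionAlong L x := by
    simp only [hst, rowmotionAlong]
    rw [List.take_of_length_le (by simp)]
  have hinv : ∀ m, m ≤ n → ∀ p, (m ≤ (L.1 p : ℕ) → st m p = x p) ∧ ((L.1 p : ℕ) < m →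
      ((st m p : PosReal) : ℝ) = (∑ C ∈ maxChainsThrough p, ∏ q ∈ C,
        if q < p then ((st m q : PosReal) : ℝ) else (x q : ℝ))⁻¹) := by
    intro m
    induction m with
    | zero => intro _ p; simp [hst]
    | succ m ih =>
      intro hm
      have ih := ih (by omega)
      set p₀ : P := L.1.symm ⟨m, hm⟩ with hp₀
      have hL₀ : (L.1 p₀ : ℕ) = m := by simp [hp₀]
      have hstep : st (m + 1) = toggleFun p₀ (st m) := by
        simp only [hst]
        rw [List.take_succ_eq_append_getElem (by simpa using hm)]
        simp only [List.map_append, List.map_cons, List.map_nil, List.reverse_append,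
          List.reverse_cons, List.reverse_nil, List.nil_append, List.singleton_append,
          List.prod_cons, Equiv.Perm.mul_apply]
        simp only [List.getElem_finRange, Fin.cast_mk]
        rfl
      have hne : ∀ q, (L.1 q : ℕ) ≠ m → st (m + 1) q = st m q := by
        intro q hq
        have : q ≠ p₀ := fun h => hq (h ▸ hL₀)
        simp [hstep, toggleFun, this]
      have hlt : ∀ q p, q < p → (L.1 q : ℕ) < L.1 p := by
        intro q p h
        exact L.2.strictMono_of_injective L.1.injective h
      intro p
      refine ⟨fun h => ?_, fun h => ?_⟩
      · rw [hne p (by omega), (ih p).1 (by omega)]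
      · by_cases hp : p = p₀
        · have hv : ((st (m + 1) p : PosReal) : ℝ)
              = (totalWeight (st m) (maxChainsThrough p))⁻¹ := by
            rw [hstep, hp]; simp [toggleFun]
          rw [hv]
          congr 1
          refine Finset.sum_congr rfl fun C hC => Finset.prod_congr rfl fun q hq => ?_
          have hC' := Finset.mem_filter.1 hC
          have hch : IsMaxChain (· ≤ ·) (C : Set P) := (Finset.mem_filter.1 hC'.1).2
          split_ifs with hqp
          · have := hlt q p hqp
            rw [hne q (by rw [hp] at this; omega)]
          · have hpq : p ≤ q := by
              rcases hch.1.total (Finset.mem_coe.2 hq) (Finset.mem_coe.2 hC'.2) with h1 | h1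
              · exact (h1.lt_or_eq.resolve_left hqp).ge
              · exact h1
            have : (L.1 p : ℕ) ≤ L.1 q := L.2 hpq
            rw [(ih q).1 (by rw [hp] at this; omega)]
        · have hpm : (L.1 p : ℕ) ≠ m := by
            intro h'
            apply hp
            rw [hp₀, Equiv.eq_symm_apply]
            exact Fin.ext h'
          rw [hne p hpm, (ih p).2 (by omega)]
          congr 1
          refine Finset.sum_congr rfl fun C _ => Finset.prod_congr rfl fun q _ => ?_
          split_ifs with hqp
          · have := hlt q p hqp
            rw [hne q (by omega)]
          · rfl
  rw [← hfin]
  exact (hinv n le_rfl p).2 (L.1 p).2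

/-- Rowmotion does not depend on the choice of the linear extension. -/
theorem rowmotion_eq_along (L : LinExt P) : rowmotion P = rowmotionAlong L := by
  classical
  ext x p
  induction p using WellFoundedLT.induction with
  | ind p ih =>
    rw [rowmotion] at ih ⊢
    rw [rowmotionAlong_spec, rowmotionAlong_spec]
    congr 1
    refine Finset.sum_congr rfl fun C _ => Finset.prod_congr rfl fun q _ => ?_
    split_ifs with hqp
    · exact ih q hqp
    · rfl

end Poset

/-! Subposets of `ℕ × ℕ` with the product order; coordinates start at `1`. -/

/-- Positive labelings of the induced subposet of `ℕ × ℕ` on `S`. -/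
abbrev Labeling (S : Finset (ℕ × ℕ)) : Type := S → PosReal

/-- Restriction of a labeling to a subset. -/
def Labeling.restrict {S S' : Finset (ℕ × ℕ)} (h : S' ⊆ S) (x : Labeling S) : Labeling S' :=
  fun p => x ⟨p.1, h p.2⟩

/-- The rectangle `[r] × [s]`. -/
def rectangle (r s : ℕ) : Finset (ℕ × ℕ) := Finset.Icc 1 r ×ˢ Finset.Icc 1 s

/-- The right trapezoid: the `(i, j)` in the rectangle `[r + s - 1] × [s]` with `i - j < r`. -/
def rightTrapezoid (r s : ℕ) : Finset (ℕ × ℕ) :=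
  (rectangle (r + s - 1) s).filter fun p => p.1 < r + p.2

/-- The trapezoid: the `(i, j)` in the right trapezoid with `i + j > s`. -/
def trapezoid (r s : ℕ) : Finset (ℕ × ℕ) :=
  (rightTrapezoid r s).filter fun p => s < p.1 + p.2

/-- The left border `{(l + r - 1, l) | 1 ≤ l ≤ s}` of the right trapezoid. -/
def leftBorder (r s : ℕ) : Finset (ℕ × ℕ) :=
  (Finset.Icc 1 s).image fun l => (l + r - 1, l)

/-- The intermediate poset `I_k`: the union of the trapezoid with parameters `r, k` and of the
interval from `(k, k + 1)` to `(r + k - 1, s)`. -/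
def intermediate (r s k : ℕ) : Finset (ℕ × ℕ) :=
  trapezoid r k ∪ (rightTrapezoid r s ∩ Finset.Icc (k, k + 1) (r + k - 1, s))

/-- The interval `M_k` from `(k, 1)` to `(r + k, k + 1)` in the right trapezoid. -/
def middle (r s k : ℕ) : Finset (ℕ × ℕ) :=
  (rightTrapezoid r s).filter fun p => (k, 1) ≤ p ∧ p ≤ (r + k, k + 1)

open scoped Classical in
/-- The polygonal chains of `I_k`: the maximal chains that meet the left border or contain
`(k, 1)`. -/
noncomputable def polygonalChains (r s k : ℕ) : Finset (Finset (intermediate r s k)) :=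
  (maxChains (intermediate r s k)).filter fun C =>
    (∃ p ∈ C, (p : ℕ × ℕ) ∈ leftBorder r s) ∨ ∃ p ∈ C, (p : ℕ × ℕ) = (k, 1)

theorem mem_rightTrapezoid {r s : ℕ} {p : ℕ × ℕ} : p ∈ rightTrapezoid r s ↔
    1 ≤ p.1 ∧ p.1 ≤ r + s - 1 ∧ 1 ≤ p.2 ∧ p.2 ≤ s ∧ p.1 < r + p.2 := by
  simp [rightTrapezoid, rectangle, and_assoc]

theorem mem_intermediate {r s k : ℕ} {p : ℕ × ℕ} : p ∈ intermediate r s k ↔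
    (1 ≤ p.1 ∧ p.1 ≤ r + k - 1 ∧ 1 ≤ p.2 ∧ p.2 ≤ k ∧ p.1 < r + p.2 ∧ k < p.1 + p.2) ∨
    ((1 ≤ p.1 ∧ p.1 ≤ r + s - 1 ∧ 1 ≤ p.2 ∧ p.2 ≤ s ∧ p.1 < r + p.2) ∧
      k ≤ p.1 ∧ k + 1 ≤ p.2 ∧ p.1 ≤ r + k - 1 ∧ p.2 ≤ s) := by
  simp [intermediate, trapezoid, mem_rightTrapezoid, and_assoc, Prod.le_def]

theorem mem_middle {r s k : ℕ} {p : ℕ × ℕ} : p ∈ middle r s k ↔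
    (1 ≤ p.1 ∧ p.1 ≤ r + s - 1 ∧ 1 ≤ p.2 ∧ p.2 ≤ s ∧ p.1 < r + p.2) ∧
      k ≤ p.1 ∧ 1 ≤ p.2 ∧ p.1 ≤ r + k ∧ p.2 ≤ k + 1 := by
  simp only [middle, Finset.mem_filter, mem_rightTrapezoid, Prod.le_def, and_assoc]

theorem middle_subset {r s k : ℕ} {p : ℕ × ℕ} (hp : p ∈ middle r s k) (h : p ≠ (k, 1)) :
    p ∈ intermediate r s (k + 1) := by
  obtain ⟨i, j⟩ := p
  simp only [mem_middle, mem_intermediate, ne_eq, Prod.mk.injEq] at *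
  omega

theorem above_mem {r s k : ℕ} {p : ℕ × ℕ} (hp : p ∈ intermediate r s k) (h : k + 1 < p.2) :
    (p.1 + 1, p.2) ∈ intermediate r s (k + 1) := by
  obtain ⟨i, j⟩ := p
  simp only [mem_intermediate] at *
  omega

theorem below_mem {r s k : ℕ} (hk : 1 ≤ k) (hks : k < s) {p : ℕ × ℕ}
    (hp : p ∈ intermediate r s k) (hM : p ∉ middle r s k) (h : ¬ k + 1 < p.2) :
    p.1 < k ∧ (p.1, p.2 + 1) ∈ intermediate r s (k + 1) := by
  obtain ⟨i, j⟩ := p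
  simp only [mem_middle, mem_intermediate] at *
  omega

theorem trapezoid_eq (r s : ℕ) : intermediate r s s = trapezoid r s := by
  ext p
  simp only [mem_intermediate, trapezoid, Finset.mem_filter, mem_rightTrapezoid]
  omega

theorem rectangle_eq (r s : ℕ) (hs : 1 ≤ s) : intermediate r s 1 = rectangle r s := by
  ext p
  simp only [mem_intermediate, rectangle, Finset.mem_product, Finset.mem_Icc]
  omega

/-- The labeling of `M_k` that agrees with `x` except that `(k, 1)` has the label `a`. -/
noncomputable def middleLabeling (r s k : ℕ) (a : PosReal)
    (x : Labeling (intermediate r s (k + 1))) : Labeling (middle r s k) :=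
  fun q => if h : (q : ℕ × ℕ) = (k, 1) then a else x ⟨q, middle_subset q.2 h⟩

/-- The map `ζ_k` from positive labelings of `I_{k+1}` to positive labelings of `I_k`, computed with
the auxiliary label `a` at `(k, 1)`: on `M_k` it is inverse rowmotion of `M_k`, the labels above
`M_k` are shifted southeast and the labels below `M_k` (in the last case, where `i < k`) are shifted
southwest. -/
noncomputable def zetaStep (r s k : ℕ) (hk : 1 ≤ k) (hks : k < s) (a : PosReal)
    (x : Labeling (intermediate r s (k + 1))) : Labeling (intermediate r s k) :=
  fun p =>
    if hM : (p : ℕ × ℕ) ∈ middle r s k then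
      ((rowmotion (middle r s k))⁻¹ (middleLabeling r s k a x)) ⟨p, hM⟩
    else if hj : k + 1 < (p : ℕ × ℕ).2 then
      x ⟨(p.1.1 + 1, p.1.2), above_mem p.2 hj⟩
    else
      x ⟨(p.1.1, p.1.2 + 1), (below_mem hk hks p.2 hM hj).2⟩

/-- The composition `ζ_1 ∘ ζ_2 ∘ ⋯ ∘ ζ_m`, where `ζ_k` is computed with the auxiliary label
`a k`. -/
noncomputable def zetaComp (r s : ℕ) (a : ℕ → PosReal) : (m : ℕ) → m < s →
    Labeling (intermediate r s (m + 1)) → Labeling (intermediate r s 1)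
  | 0, _ => id
  | m + 1, h =>
    zetaComp r s a m (Nat.lt_of_succ_lt h) ∘ zetaStep r s (m + 1) (Nat.le_add_left 1 m) h (a (m + 1))

/-- The map `ζ = ζ_1 ∘ ζ_2 ∘ ⋯ ∘ ζ_{s-1}` from positive labelings of the trapezoid, which is `I_s`,
to positive labelings of the rectangle, which is `I_1`. -/
noncomputable def zeta (r s : ℕ) (hs : 1 ≤ s) (a : ℕ → PosReal) (x : Labeling (trapezoid r s)) :
    Labeling (rectangle r s) :=
  (zetaComp r s a (s - 1) (Nat.sub_lt hs Nat.one_pos)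
    (x.restrict (by rw [Nat.sub_add_cancel hs, trapezoid_eq]))).restrict
      (by rw [rectangle_eq r s hs])

end RectTrap

/-! Part 1 follows from part 2 by composition: the top of `I_s` lies on the left border and the
bottom of `I_1` is `(1, 1)`, so in both posets every maximal chain is polygonal.

For a single step, rowmotion is encoded by chain sums: the weights of saturated chains from the
bottom up to `p` after rowmotion are reciprocal to those from `p` to the top before it
(`chainSum_rowmotion_mul`). With `f` the upward chain sums of `M_k` under the new labels `y`, both
labelings become local functions of one potential: `y i j * (f (i+1) j + f i (j+1)) = f i j` and `x
i j * (1 / f (i-1) j + 1 / f i (j-1)) = 1 / f i j`.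

Let `X`, `W` be the downward chain sums of `I_{k+1}`, `I_k`, and `XN`, `WN` those of chains avoiding
the left border and `(k+1, 1)`, respectively `(k, 1)`. In a unit square the local relations split
the difference of `X * f` between the two middle corners in proportion to `f` (`square_shift`).
Propagated from the boundary of `M_k`, this expresses increments of `X * f` by `WN` and increments
of `XN * f` by `W`: the two kinds of sums are exchanged. Subtracting along the top row of `M_k`
gives `X - XN = W - WN`, up to a shift by one in `i`. Above `M_k` the labels shift in the same way,
so the identity reaches the top element, where it compares the weights of polygonal chains
(`chain_shift`). -/

namespace RectTrap

/-! ### Chain sums in a finite poset and their inversion by rowmotion -/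

section ChainSums

variable {P : Type} [Fintype P] [PartialOrder P]

open scoped Classical in
/-- The maximal chains of the principal ideal below `p`. -/
noncomputable def chainsTo (p : P) : Finset (Finset P) :=
  Finset.univ.filter fun C => IsChain (· ≤ ·) (C : Set P) ∧ p ∈ C ∧ (∀ q ∈ C, q ≤ p) ∧
    ∀ z ≤ p, (∀ c ∈ C, c ≤ z ∨ z ≤ c) → z ∈ C

theorem mem_chainsTo {p : P} {C : Finset P} : C ∈ chainsTo p ↔
    IsChain (· ≤ ·) (C : Set P) ∧ p ∈ C ∧ (∀ q ∈ C, q ≤ p) ∧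
      ∀ z ≤ p, (∀ c ∈ C, c ≤ z ∨ z ≤ c) → z ∈ C := by
  simp [chainsTo]

/-- The sum of the weights of the maximal chains of the principal ideal below `p`, for arbitrary
real labels. -/
noncomputable def chainSum (z : P → ℝ) (p : P) : ℝ := ∑ C ∈ chainsTo p, ∏ q ∈ C, z q

theorem chainSum_of_isMin (z : P → ℝ) {p : P} (hp : IsMin p) : chainSum z p = z p := by
  have : chainsTo p = {{p}} := by
    ext C
    simp only [mem_chainsTo, Finset.mem_singleton]
    constructor
    · rintro ⟨-, h1, h2, -⟩
      ext q
      simp only [Finset.mem_singleton]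
      exact ⟨fun h => (h2 q h).antisymm (hp (h2 q h)), fun h => h ▸ h1⟩
    · rintro rfl
      refine ⟨by simp, by simp, by simp, fun z hz _ => ?_⟩
      simpa using hz.antisymm (hp hz)
  simp [chainSum, this]

open scoped Classical in
-- Removing `p` from a saturated chain ending at `p` leaves a saturated chain ending at an element
-- covered by `p`. This recursion is the only access to chain sums used later.
theorem chainSum_of_not_isMin (z : P → ℝ) {p : P} (hp : ¬ IsMin p) :
    chainSum z p = z p * ∑ q with q ⋖ p, chainSum z q := by
  simp only [chainSum]
  rw [Finset.sum_sigma', Finset.mul_sum]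
  symm
  have hnot : ∀ a : (_ : P) × Finset P,
      a ∈ (Finset.univ.filter fun q => q ⋖ p).sigma (fun q => chainsTo q) → p ∉ a.2 := by
    rintro ⟨q, C⟩ h hpC
    simp only [Finset.mem_sigma, Finset.mem_filter, Finset.mem_univ, true_and, mem_chainsTo] at h
    exact (h.1.lt.trans_le (h.2.2.2.1 p hpC)).false
  refine Finset.sum_bij (fun a _ => insert p a.2) ?_ ?_ ?_ ?_
  · rintro ⟨q, C⟩ h
    simp only [Finset.mem_sigma, Finset.mem_filter, Finset.mem_univ, true_and, mem_chainsTo] at h ⊢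
    obtain ⟨hq, h1, h2, h3, h4⟩ := h
    refine ⟨?_, by simp, ?_, ?_⟩
    · rw [Finset.coe_insert]
      exact h1.insert fun b hb _ => Or.inr ((h3 b hb).trans hq.le)
    · intro c hc
      rcases Finset.mem_insert.1 hc with rfl | hc
      · exact le_rfl
      · exact (h3 c hc).trans hq.le
    · intro y hy hc
      rcases hy.eq_or_lt with rfl | hlt
      · simp
      refine Finset.mem_insert_of_mem ?_
      have hyq : y ≤ q := by
        rcases hc q (Finset.mem_insert_of_mem h2) with h | h
        · rcases h.eq_or_lt with rfl | h
          · exact le_rfl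
          · exact (hq.2 h hlt).elim
        · exact h
      exact h4 y hyq fun c hcC => hc c (Finset.mem_insert_of_mem hcC)
  · rintro ⟨q, C⟩ h ⟨q', C'⟩ h' heq
    have hC : C = C' := by
      have h1 := hnot _ h
      have h2 := hnot _ h'
      simp only at heq h1 h2
      rw [← Finset.erase_insert h1, heq, Finset.erase_insert h2]
    subst hC
    simp only [Finset.mem_sigma, mem_chainsTo] at h h'
    have : q = q' := (h'.2.2.2.1 q h.2.2.1).antisymm (h.2.2.2.1 q' h'.2.2.1)
    rw [this]
  · intro C hC
    obtain ⟨h1, h2, h3, h4⟩ := mem_chainsTo.1 hC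
    have hne : (C.erase p).Nonempty := by
      by_contra hempty
      apply hp
      intro y hy
      have : y ∈ C := h4 y hy fun c hc => by
        have : c = p := by
          by_contra hcp
          exact hempty ⟨c, Finset.mem_erase.2 ⟨hcp, hc⟩⟩
        exact Or.inr (this ▸ hy)
      by_contra hpy
      exact hempty ⟨y, Finset.mem_erase.2 ⟨fun h => hpy h.ge, this⟩⟩
    -- The largest element of the chain below `p`; saturation forces `p` to cover it.
    obtain ⟨q, hq, hmax⟩ := (C.erase p).exists_maximal hne
    have hqC := Finset.mem_of_mem_erase hq
    have hqp : q < p := (h3 q hqC).lt_of_ne (Finset.ne_of_mem_erase hq)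
    have hgr : ∀ c ∈ C.erase p, c ≤ q := by
      intro c hc
      rcases h1.total (Finset.mem_coe.2 (Finset.mem_of_mem_erase hc)) hqC with h | h
      · exact h
      · exact hmax hc h
    refine ⟨⟨q, C.erase p⟩, ?_, Finset.insert_erase h2⟩
    simp only [Finset.mem_sigma, Finset.mem_filter, Finset.mem_univ, true_and, mem_chainsTo]
    refine ⟨⟨hqp, ?_⟩, h1.mono (by simp), hq, hgr, ?_⟩
    · intro y hqy hyp
      have : y ∈ C := h4 y hyp.le fun c hc => by
        by_cases hcp : c = p
        · exact Or.inr (hcp ▸ hyp.le)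
        · exact Or.inl ((hgr c (Finset.mem_erase.2 ⟨hcp, hc⟩)).trans hqy.le)
      exact (hqy.trans_le (hgr y (Finset.mem_erase.2 ⟨hyp.ne, this⟩))).false
    · intro y hy hc
      refine Finset.mem_erase.2 ⟨(hy.trans_lt hqp).ne, h4 y (hy.trans hqp.le) fun c hcC => ?_⟩
      by_cases hcp : c = p
      · exact Or.inr (hcp ▸ hy.trans hqp.le)
      · exact hc c (Finset.mem_erase.2 ⟨hcp, hcC⟩)
  · intro a ha
    rw [Finset.prod_insert (hnot a ha)]

/-- Maximality need only be tested by adding one comparable element at a time, which is the form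
shared with `chainsTo`. -/
theorem mem_maxChains {C : Finset P} : C ∈ maxChains P ↔
    IsChain (· ≤ ·) (C : Set P) ∧ ∀ z, (∀ c ∈ C, c ≤ z ∨ z ≤ c) → z ∈ C := by
  classical
  simp only [maxChains, Finset.mem_filter, Finset.mem_univ, true_and]
  constructor
  · rintro ⟨h1, h2⟩
    refine ⟨h1, fun z hz => ?_⟩
    have := h2 (h1.insert (a := z) fun b hb _ => (hz b hb).symm) (Set.subset_insert _ _)
    exact Finset.mem_coe.1 (this ▸ Set.mem_insert _ _)
  · rintro ⟨h1, h2⟩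
    refine ⟨h1, fun t ht hst => hst.antisymm fun z hz => ?_⟩
    exact h2 z fun c hc => ht.total (hst hc) hz

theorem maxChains_eq_chainsTo {t : P} (ht : IsTop t) : maxChains P = chainsTo t := by
  ext C
  rw [mem_maxChains, mem_chainsTo]
  exact ⟨fun h => ⟨h.1, h.2 t fun c _ => Or.inl (ht c), fun q _ => ht q, fun z _ => h.2 z⟩,
    fun h => ⟨h.1, fun z => h.2.2.2 z (ht z)⟩⟩

/-- The maximal chains of the principal filter above `p`. -/
noncomputable def chainsFrom (p : P) : Finset (Finset P) :=
  chainsTo (P := Pᵒᵈ) (OrderDual.toDual p)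

theorem mem_chainsFrom {p : P} {C : Finset P} : C ∈ chainsFrom p ↔
    IsChain (· ≤ ·) (C : Set P) ∧ p ∈ C ∧ (∀ q ∈ C, p ≤ q) ∧
      ∀ z, p ≤ z → (∀ c ∈ C, c ≤ z ∨ z ≤ c) → z ∈ C := by
  refine (mem_chainsTo (P := Pᵒᵈ) (p := OrderDual.toDual p) (C := C)).trans ?_
  refine and_congr ⟨fun h => h.symm, fun h => h.symm⟩ (and_congr Iff.rfl (and_congr Iff.rfl ?_))
  exact ⟨fun h z hz hc => h z hz fun c hcC => (hc c hcC).symm,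
    fun h z hz hc => h z hz fun c hcC => (hc c hcC).symm⟩

/-- The sum of the weights of the maximal chains of the principal filter above `p`. -/
noncomputable def chainSumFrom (z : P → ℝ) (p : P) : ℝ := ∑ C ∈ chainsFrom p, ∏ q ∈ C, z q

theorem chainSumFrom_eq (z : P → ℝ) (p : P) : chainSumFrom z p =
    chainSum (P := Pᵒᵈ) (fun q => z (OrderDual.ofDual q)) (OrderDual.toDual p) := rfl

open scoped Classical in
theorem chainSumFrom_of_not_isMax (z : P → ℝ) {p : P} (hp : ¬ IsMax p) :
    chainSumFrom z p = z p * ∑ q with p ⋖ q, chainSumFrom z q := by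
  refine (chainSumFrom_eq z p).trans ((chainSum_of_not_isMin _ fun h => hp h.ofDual).trans ?_)
  congr 1
  refine Finset.sum_equiv OrderDual.ofDual (fun q => ?_) fun q _ => rfl
  simp only [Finset.mem_filter, Finset.mem_univ, true_and]
  exact ofDual_covBy_ofDual_iff.symm

open scoped Classical in
/-- A maximal chain through `p` consists of a maximal chain below and one above `p`. -/
theorem sum_maxChainsThrough (u v : P → ℝ) (p : P) :
    u p * ∑ C ∈ maxChainsThrough p, ∏ q ∈ C, (if q < p then u q else v q) =
      chainSum u p * chainSumFrom v p := by
  rw [chainSum, chainSumFrom, Finset.sum_mul_sum, ← Finset.sum_product', Finset.mul_sum]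
  have hT : ∀ C : Finset P, C ∈ maxChainsThrough p ↔ (IsChain (· ≤ ·) (C : Set P) ∧
      ∀ z, (∀ c ∈ C, c ≤ z ∨ z ≤ c) → z ∈ C) ∧ p ∈ C := by
    intro C
    rw [maxChainsThrough, Finset.mem_filter, mem_maxChains]
  have hlow : ∀ C ∈ maxChainsThrough p, C.filter (· ≤ p) ∈ chainsTo p := by
    intro C hC
    obtain ⟨⟨h1, h2⟩, h3⟩ := (hT C).1 hC
    refine mem_chainsTo.2 ⟨h1.mono (Finset.coe_subset.2 (Finset.filter_subset _ _)), by simp [h3], by simp, fun z hz hc => ?_⟩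
    refine Finset.mem_filter.2 ⟨h2 z fun c hcC => ?_, hz⟩
    rcases h1.total (Finset.mem_coe.2 hcC) h3 with h | h
    · exact hc c (Finset.mem_filter.2 ⟨hcC, h⟩)
    · exact Or.inr (hz.trans h)
  have hup : ∀ C ∈ maxChainsThrough p,
      C.filter (p ≤ ·) ∈ chainsFrom p := by
    intro C hC
    obtain ⟨⟨h1, h2⟩, h3⟩ := (hT C).1 hC
    refine mem_chainsFrom.2 ⟨h1.mono (Finset.coe_subset.2 (Finset.filter_subset _ _)), by simp [h3], by simp, fun z hz hc => ?_⟩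
    refine Finset.mem_filter.2 ⟨h2 z fun c hcC => ?_, hz⟩
    rcases h1.total (Finset.mem_coe.2 hcC) h3 with h | h
    · exact Or.inl (h.trans hz)
    · exact hc c (Finset.mem_filter.2 ⟨hcC, h⟩)
  refine Finset.sum_bij' (fun C _ => ((C.filter (· ≤ p), C.filter (p ≤ ·)) : Finset P × Finset P))
    (fun A _ => A.1 ∪ A.2) ?_ ?_ ?_ ?_ ?_
  · intro C hC
    exact Finset.mem_product.2 ⟨hlow C hC, hup C hC⟩
  · rintro ⟨A, B⟩ hAB
    obtain ⟨hA, hB⟩ := Finset.mem_product.1 hAB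
    obtain ⟨a1, a2, a3, a4⟩ := mem_chainsTo.1 hA
    obtain ⟨b1, b2, b3, b4⟩ := mem_chainsFrom.1 hB
    refine (hT _).2 ⟨⟨?_, ?_⟩, Finset.mem_union_left _ a2⟩
    · intro c hc d hd hne
      simp only [Finset.coe_union, Set.mem_union, Finset.mem_coe] at hc hd
      rcases hc with hc | hc <;> rcases hd with hd | hd
      · exact a1 hc hd hne
      · exact Or.inl ((a3 c hc).trans (b3 d hd))
      · exact Or.inr ((a3 d hd).trans (b3 c hc))
      · exact b1 hc hd hne
    · intro z hz
      rcases hz p (Finset.mem_union_left _ a2) with h | h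
      · exact Finset.mem_union_right _ (b4 z h fun c hc => hz c (Finset.mem_union_right _ hc))
      · exact Finset.mem_union_left _ (a4 z h fun c hc => hz c (Finset.mem_union_left _ hc))
  · intro C hC
    obtain ⟨⟨h1, -⟩, h3⟩ := (hT C).1 hC
    ext c
    simp only [Finset.mem_union, Finset.mem_filter]
    exact ⟨fun h => h.elim And.left And.left,
      fun h => (h1.total (Finset.mem_coe.2 h) h3).imp (And.intro h) (And.intro h)⟩
  · rintro ⟨A, B⟩ hAB
    obtain ⟨hA, hB⟩ := Finset.mem_product.1 hAB
    obtain ⟨a1, a2, a3, a4⟩ := mem_chainsTo.1 hA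
    obtain ⟨b1, b2, b3, b4⟩ := mem_chainsFrom.1 hB
    refine Prod.ext ?_ ?_
    · ext c
      simp only [Finset.mem_union, Finset.mem_filter]
      refine ⟨fun h => h.1.elim id fun hc => ?_, fun h => ⟨Or.inl h, a3 c h⟩⟩
      rwa [h.2.antisymm (b3 c hc)]
    · ext c
      simp only [Finset.mem_union, Finset.mem_filter]
      refine ⟨fun h => h.1.elim (fun hc => ?_) id, fun h => ⟨Or.inr h, b3 c h⟩⟩
      rwa [(a3 c hc).antisymm h.2]
  · intro C hC
    obtain ⟨⟨h1, -⟩, h3⟩ := (hT C).1 hC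
    -- The element `p` lies in both halves of the chain, whereas the mixed product contains only `v
    -- p`; the extra factor `u p` makes up for it.
    change _ = (∏ q ∈ C.filter (· ≤ p), u q) * ∏ q ∈ C.filter (p ≤ ·), v q
    rw [Finset.prod_ite]
    have e1 : C.filter (· ≤ p) = insert p (C.filter (· < p)) := by
      ext c
      simp only [Finset.mem_insert, Finset.mem_filter, le_iff_lt_or_eq]
      constructor
      · rintro ⟨h, h' | h'⟩
        exacts [Or.inr ⟨h, h'⟩, Or.inl h']
      · rintro (rfl | h)
        exacts [⟨h3, Or.inr rfl⟩, ⟨h.1, Or.inl h.2⟩]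
    have e2 : C.filter (p ≤ ·) = C.filter (fun q => ¬ q < p) := by
      refine Finset.filter_congr fun c hc => ⟨fun h => h.not_gt, fun h => ?_⟩
      rcases h1.total (Finset.mem_coe.2 hc) h3 with h' | h'
      · exact (h'.lt_or_eq.resolve_left h).ge
      · exact h'
    rw [e1, e2, Finset.prod_insert (by simp), mul_assoc]

theorem chainSum_pos {z : P → ℝ} (hz : ∀ q, 0 < z q) (p : P) : 0 < chainSum z p := by
  induction p using WellFoundedLT.induction with
  | ind p ih =>
    by_cases hp : IsMin p
    · rw [chainSum_of_isMin z hp]; exact hz p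
    · classical
      rw [chainSum_of_not_isMin z hp]
      obtain ⟨q, hq⟩ := not_isMin_iff.1 hp
      obtain ⟨q', -, hq'⟩ := exists_le_covBy_of_lt hq
      exact mul_pos (hz p) (Finset.sum_pos (fun q hq => ih q (Finset.mem_filter.1 hq).2.lt)
        ⟨q', by simpa using hq'⟩)

/-- Rowmotion inverts the chain sums: those below for the new labels are the inverses of those above
for the old ones. -/
theorem chainSum_rowmotion_mul (y : P → PosReal) (p : P) :
    chainSum (fun q => (rowmotion P y q : ℝ)) p *
      chainSumFrom (fun q => (y q : ℝ)) p = 1 := by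
  classical
  rw [← sum_maxChainsThrough (fun q => (rowmotion P y q : ℝ)) (fun q => (y q : ℝ))]
  have h := rowmotionAlong_spec (Classical.arbitrary (LinExt P)) y p
  have hpos : 0 < ((rowmotion P y p : PosReal) : ℝ) := (rowmotion P y p).2
  change ((rowmotion P y p : PosReal) : ℝ) = (∑ C ∈ maxChainsThrough p, ∏ q ∈ C,
    if q < p then ((rowmotion P y q : PosReal) : ℝ) else (y q : ℝ))⁻¹ at h
  nth_rewrite 1 [h]
  -- A vanishing sum would make the new label at `p` equal to `0⁻¹ = 0`, but labels are positive.
  refine inv_mul_cancel₀ fun h0 => ?_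
  rw [h0, inv_zero] at h
  exact hpos.ne' h

open scoped Classical in
/-- The total weight of the maximal chains that meet a given subset. -/
theorem totalWeight_meeting (x : P → PosReal) {t : P} (ht : IsTop t) (m : P → Prop) :
    totalWeight x ((maxChains P).filter fun C => ∃ p ∈ C, m p) =
      chainSum (fun q => (x q : ℝ)) t - chainSum (fun q => if m q then 0 else (x q : ℝ)) t := by
  have h0 : ∀ C : Finset P, (∏ q ∈ C, if m q then 0 else (x q : ℝ)) =
      if ∃ p ∈ C, m p then 0 else weight x C := by
    intro C
    split_ifs with h
    · obtain ⟨p, hp, hm⟩ := h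
      exact Finset.prod_eq_zero hp (if_pos hm)
    · push Not at h
      exact Finset.prod_congr rfl fun q hq => if_neg (h q hq)
  rw [totalWeight, chainSum, chainSum, ← maxChains_eq_chainsTo ht, Finset.sum_filter,
    ← Finset.sum_sub_distrib]
  refine Finset.sum_congr rfl fun C _ => ?_
  rw [h0]
  split_ifs <;> simp [weight]

end ChainSums

/-! ### The chain shifting recurrence -/

/-- Chain shifting in a single square with corners `a`, `b`, `c`, `d`, where `d` covers `b` and `c`,
which cover `a`. -/
theorem square_shift {xd ya fa fb fc fd Xb Xc Xd Wa w : ℝ} (hb : 0 < fb) (hc : 0 < fc) (hd : 0 < fd)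
    (hy : ya * (fb + fc) = fa) (hx : xd * (fc⁻¹ + fb⁻¹) = fd⁻¹) (hX : Xd = xd * (Xc + Xb))
    (hW : Wa = ya * w) (hs : Xc * fc - Xb * fb = w * fa) :
    Xc * fc - Xd * fd = Wa * fc ∧ Xd * fd - Xb * fb = Wa * fb := by
  have hbc : fb + fc ≠ 0 := by positivity
  have hxd : xd * fd * (fb + fc) = fb * fc := by
    field_simp at hx
    linarith
  -- Since `xd * fd = fb * fc / (fb + fc)`, the value `Xd * fd` divides the difference `Xc * fc - Xb
  -- * fb` in the ratio `fc : fb`.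
  have e : (Xc * fc - Xd * fd - Wa * fc) * (fb + fc) = 0 := by
    rw [hX, hW]
    linear_combination (-(Xc + Xb)) * hxd + fc * hs - w * fc * hy
  have e' := (mul_eq_zero.1 e).resolve_right hbc
  refine ⟨by linarith, ?_⟩
  have e2 : Wa * (fb + fc) = w * fa := by rw [hW, ← hy]; ring
  linarith

/-- The recurrence behind chain shifting. `x` and `y` are related by rowmotion of the middle poset
through the potential `f`. `X` and `W` are chain sums of the intermediate posets, `XN` and `WN` those
of the chains that are not polygonal. -/
theorem chain_shift {r s k : ℕ} (hk : 1 ≤ k) (hks : k < s) (hsr : s ≤ r)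
    {x y f X XN W WN : ℕ → ℕ → ℝ}
    (f0 : ∀ i j, (i, j) ∉ middle r s k → f i j = 0)
    (fpos : ∀ i j, (i, j) ∈ middle r s k → 0 < f i j)
    (hy : ∀ i j, (i, j) ∈ middle r s k → (i, j) ≠ (r + k, k + 1) →
      y i j * (f (i + 1) j + f i (j + 1)) = f i j)
    (hx : ∀ i j, (i, j) ∈ middle r s k → (i, j) ≠ (k, 1) →
      x i j * ((f (i - 1) j)⁻¹ + (f i (j - 1))⁻¹) = (f i j)⁻¹)
    (hX0 : ∀ i j, (i, j) ∉ intermediate r s (k + 1) → X i j = 0)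
    (hX : ∀ i j, (i, j) ∈ intermediate r s (k + 1) →
      X i j = x i j * (X (i - 1) j + X i (j - 1) + if i + j = k + 2 then 1 else 0))
    (hXN0 : ∀ i j, (i, j) ∉ intermediate r s (k + 1) ∨ i + 1 = r + j ∨ (i, j) = (k + 1, 1) →
      XN i j = 0)
    (hXN : ∀ i j, (i, j) ∈ intermediate r s (k + 1) → ¬ (i + 1 = r + j ∨ (i, j) = (k + 1, 1)) →
      XN i j = x i j * (XN (i - 1) j + XN i (j - 1) + if i + j = k + 2 then 1 else 0))
    (hW0 : ∀ i j, (i, j) ∉ intermediate r s k → W i j = 0)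
    (hW : ∀ i j, (i, j) ∈ intermediate r s k →
      W i j = y i j * (W (i - 1) j + W i (j - 1) + if i + j = k + 1 then 1 else 0))
    (hWN0 : ∀ i j, (i, j) ∉ intermediate r s k ∨ i + 1 = r + j ∨ (i, j) = (k, 1) → WN i j = 0)
    (hWN : ∀ i j, (i, j) ∈ intermediate r s k → ¬ (i + 1 = r + j ∨ (i, j) = (k, 1)) →
      WN i j = y i j * (WN (i - 1) j + WN i (j - 1) + if i + j = k + 1 then 1 else 0))
    (hA : ∀ i j, (i, j) ∈ intermediate r s k → i < k → y i j = x i (j + 1))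
    (hB : ∀ i j, (i, j) ∈ intermediate r s k → k + 1 < j → y i j = x (i + 1) j) :
    X (r + k) s - XN (r + k) s = W (r + k - 1) s - WN (r + k - 1) s := by
  simp only [mem_middle, mem_intermediate, ne_eq, Prod.mk.injEq] at *
  -- On the boundary of `M_k` one lower neighbour is missing, and its reciprocal is `0⁻¹ = 0`. The
  -- relation for `x` then just moves `f` to the other neighbour.
  have hx' : ∀ i j, k ≤ i → i ≤ r + k → 1 ≤ j → j ≤ k + 1 → i < r + j → ¬ (i = k ∧ j = 1) →
      (f (i - 1) j)⁻¹ = 0 → x i j * f i j = f i (j - 1) := by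
    intro i j h1 h2 h3 h4 h5 h6 h7
    have h := hx i j (by omega) h6
    have h8 := fpos i j (by omega)
    rw [h7, zero_add] at h
    have h9 : (f i (j - 1))⁻¹ ≠ 0 := fun h0 => by
      rw [h0, mul_zero] at h
      exact (inv_pos.2 h8).ne h
    have h10 : f i (j - 1) ≠ 0 := fun h0 => h9 (by rw [h0, inv_zero])
    have h11 := h8.ne'
    field_simp at h
    linarith
  have hx'' : ∀ i j, k ≤ i → i ≤ r + k → 1 ≤ j → j ≤ k + 1 → i < r + j → ¬ (i = k ∧ j = 1) →
      (f i (j - 1))⁻¹ = 0 → x i j * f i j = f (i - 1) j := by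
    intro i j h1 h2 h3 h4 h5 h6 h7
    have h := hx i j (by omega) h6
    have h8 := fpos i j (by omega)
    rw [h7, add_zero] at h
    have h9 : (f (i - 1) j)⁻¹ ≠ 0 := fun h0 => by
      rw [h0, mul_zero] at h
      exact (inv_pos.2 h8).ne h
    have h10 : f (i - 1) j ≠ 0 := fun h0 => h9 (by rw [h0, inv_zero])
    have h11 := h8.ne'
    field_simp at h
    linarith
  -- the region to the left of the middle poset
  have eqX : ∀ n i j, i + j ≤ n → i ≤ k → XN i j = X i j := by
    intro n
    induction n with
    | zero => intro i j _ _; rw [hX0 _ _ (by omega), hXN0 _ _ (by omega)]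
    | succ n ih =>
      intro i j hij hi
      by_cases h : 1 ≤ i ∧ 1 ≤ j ∧ j ≤ k + 1 ∧ k + 1 < i + j
      · rw [hX i j (by omega), hXN i j (by omega) (by omega), ih (i - 1) j (by omega) (by omega),
          ih i (j - 1) (by omega) hi]
      · rw [hX0 _ _ (by omega), hXN0 _ _ (by omega)]
  have eqW : ∀ n i j, i + j ≤ n → i < k → WN i j = W i j := by
    intro n
    induction n with
    | zero => intro i j _ _; rw [hW0 _ _ (by omega), hWN0 _ _ (by omega)]
    | succ n ih =>
      intro i j hij hi
      by_cases h : 1 ≤ i ∧ 1 ≤ j ∧ j ≤ k ∧ k < i + j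
      · rw [hW i j (by omega), hWN i j (by omega) (by omega), ih (i - 1) j (by omega) (by omega),
          ih i (j - 1) (by omega) hi]
      · rw [hW0 _ _ (by omega), hWN0 _ _ (by omega)]
  -- Here labels move by one in `j`, and the minimal elements `i + j = k + 2` of `I_{k+1}` move to
  -- `i + j = k + 1`.
  have eqA : ∀ n i j, i + j ≤ n → i < k → X i (j + 1) = W i j := by
    intro n
    induction n with
    | zero => intro i j _ _; rw [hX0 _ _ (by omega), hW0 _ _ (by omega)]
    | succ n ih =>
      intro i j hij hi
      by_cases h : 1 ≤ i ∧ 1 ≤ j ∧ j ≤ k ∧ k < i + j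
      · have h1 := ih (i - 1) j (by omega) (by omega)
        have h2 := ih i (j - 1) (by omega) hi
        rw [Nat.sub_add_cancel h.2.1] at h2
        rw [hX i (j + 1) (by omega), hW i j (by omega), hA i j (by omega) hi, h1,
          Nat.add_sub_cancel, h2]
        simp only [← add_assoc, Nat.add_right_cancel_iff]
      · rw [hX0 _ _ (by omega), hW0 _ _ (by omega)]
  replace eqX := fun i j h => eqX (i + j) i j le_rfl h
  replace eqW := fun i j h => eqW (i + j) i j le_rfl h
  replace eqA := fun i j h => eqA (i + j) i j le_rfl h
  -- the bottom row
  have botN : ∀ i, XN i 1 = 0 := by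
    intro i
    induction i with
    | zero => exact hXN0 _ _ (by omega)
    | succ i ih =>
      by_cases h : k + 1 < i + 1 ∧ i + 1 + 1 < r + 1
      · rw [hXN _ _ (by omega) (by omega), Nat.add_sub_cancel, ih, hXN0 _ (1 - 1) (by omega),
          if_neg (by omega)]
        ring
      · exact hXN0 _ _ (by omega)
  -- The only chain below `(i, 1)` runs along the row from `(k + 1, 1)`, so the product telescopes.
  -- That starting point is marked, which is why `XN` vanishes on the row.
  have bot : ∀ i, k < i → i ≤ r → X i 1 * f i 1 = f k 1 := by
    intro i hi
    induction i, hi using Nat.le_induction with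
    | base =>
      intro h
      have e := hx'' (k + 1) 1 (by omega) (by omega) le_rfl (by omega) (by omega) (by omega)
        (by rw [f0 _ (1 - 1) (by omega), inv_zero])
      rw [hX _ _ (by omega), hX0 (k + 1 - 1) 1 (by omega), hX0 (k + 1) (1 - 1) (by omega),
        if_pos (by omega)]
      rw [Nat.add_sub_cancel] at e
      linarith
    | succ i hi ih =>
      intro h
      have e := hx'' (i + 1) 1 (by omega) (by omega) le_rfl (by omega) (by omega) (by omega)
        (by rw [f0 _ (1 - 1) (by omega), inv_zero])
      rw [hX _ _ (by omega), hX0 (i + 1) (1 - 1) (by omega), if_neg (by omega),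
        Nat.add_sub_cancel, add_zero, add_zero]
      rw [Nat.add_sub_cancel] at e
      rw [mul_right_comm, e, mul_comm, ih (by omega)]
  -- the left column
  have col : ∀ j, 1 ≤ j → j ≤ k → X k (j + 1) * f k (j + 1) - X k j * f k j =
      (W (k - 1) j + if k + j = k + 1 then 1 else 0) * f k j := by
    intro j h1 h2
    have e := hx' k (j + 1) le_rfl (by omega) (by omega) (by omega) (by omega) (by omega)
      (by rw [f0 (k - 1) _ (by omega), inv_zero])
    -- The neighbour `(k - 1, j + 1)` lies in the shifted region, where `eqA` turns `X` into `W`.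
    rw [hX k (j + 1) (by omega), eqA _ _ (by omega), Nat.add_sub_cancel]
    rw [Nat.add_sub_cancel] at e
    have : (k + (j + 1) = k + 2) = (k + j = k + 1) := by rw [eq_iff_iff]; omega
    simp only [this]
    linear_combination (W (k - 1) j + X k j + if k + j = k + 1 then 1 else 0) * e
  -- The square at `(i, j)`: `XN` is paired with `W`, and `X` with `WN`. The second pair of
  -- identities needs `(i + 1, j)` and is therefore absent on the left border.
  have shift : ∀ n i j, i + j ≤ n → k ≤ i → 1 ≤ j → j ≤ k → i < r + j →
      (XN i (j + 1) * f i (j + 1) - XN (i + 1) (j + 1) * f (i + 1) (j + 1) = W i j * f i (j + 1) ∧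
      X i (j + 1) * f i (j + 1) - X (i + 1) (j + 1) * f (i + 1) (j + 1) = WN i j * f i (j + 1)) ∧
      (i + 1 < r + j →
      XN (i + 1) (j + 1) * f (i + 1) (j + 1) - XN (i + 1) j * f (i + 1) j = W i j * f (i + 1) j ∧
      X (i + 1) (j + 1) * f (i + 1) (j + 1) - X (i + 1) j * f (i + 1) j = WN i j * f (i + 1) j) := by
    intro n
    induction n with
    | zero => intro i j; omega
    | succ n ih =>
      intro i j hij hi hj hjk hir
      have fc := fpos i (j + 1) (by omega)
      have fd := fpos (i + 1) (j + 1) (by omega)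
      have hya := hy i j (by omega) (by omega)
      have hxd := hx (i + 1) (j + 1) (by omega) (by omega)
      rw [Nat.add_sub_cancel, Nat.add_sub_cancel] at hxd
      -- `lc` comes from the square to the left or from the left column, `ld` below from the square
      -- underneath or from the bottom row. Their sum is the hypothesis of `square_shift`, with `w`
      -- the bracket in the recurrence of `W` or `WN`. For `X` and `WN` the corner `(k, 1)` is
      -- exceptional.
      have lc : XN i (j + 1) * f i (j + 1) - XN i j * f i j =
          (W (i - 1) j + if i + j = k + 1 then 1 else 0) * f i j ∧ (¬ (i = k ∧ j = 1) →
          X i (j + 1) * f i (j + 1) - X i j * f i j =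
          (WN (i - 1) j + if i + j = k + 1 then 1 else 0) * f i j) := by
        rcases hi.eq_or_lt with rfl | hi
        · rw [eqX _ _ le_rfl, eqX _ _ le_rfl, eqW _ _ (by omega)]
          exact ⟨col j hj hjk, fun _ => col j hj hjk⟩
        · rw [if_neg (by omega), add_zero, add_zero]
          have h := (ih (i - 1) j (by omega) (by omega) hj hjk (by omega)).2 (by omega)
          rw [Nat.sub_add_cancel (by omega)] at h
          exact ⟨h.1, fun _ => h.2⟩
      rcases Nat.lt_or_ge (i + 1) (r + j) with hb | hb
      · have fb := fpos (i + 1) j (by omega)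
        have ld : XN i j * f i j - XN (i + 1) j * f (i + 1) j = W i (j - 1) * f i j ∧
            (¬ (i = k ∧ j = 1) →
            X i j * f i j - X (i + 1) j * f (i + 1) j = WN i (j - 1) * f i j) := by
          rcases hj.eq_or_lt with rfl | hj
          · rw [botN, botN, hW0 i (1 - 1) (by omega), hWN0 i (1 - 1) (by omega)]
            refine ⟨by ring, fun h => ?_⟩
            rw [bot i (by omega) (by omega), bot (i + 1) (by omega) (by omega)]
            ring
          · have h := (ih i (j - 1) (by omega) hi (by omega) (by omega) (by omega)).1
            rw [Nat.sub_add_cancel (by omega)] at h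
            exact ⟨h.1, fun _ => h.2⟩
        have hXNd := hXN (i + 1) (j + 1) (by omega) (by omega)
        rw [Nat.add_sub_cancel, Nat.add_sub_cancel, if_neg (by omega), add_zero] at hXNd
        have hN := square_shift fb fc fd hya hxd hXNd
          (hW i j (by omega)) (by linear_combination lc.1 + ld.1)
        have hXd := hX (i + 1) (j + 1) (by omega)
        rw [Nat.add_sub_cancel, Nat.add_sub_cancel, if_neg (by omega), add_zero] at hXd
        -- At the corner `(k, 1)` is marked, so `WN` vanishes and `w = 0` is needed. Indeed `X * f`
        -- equals `f k 1` at both `(k, 2)` and `(k + 1, 1)`.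
        by_cases hcor : i = k ∧ j = 1
        · obtain ⟨rfl, rfl⟩ := hcor
          have h1 := col 1 le_rfl hk
          rw [hX0 i 1 (by omega), hW0 (i - 1) 1 (by omega), if_pos rfl] at h1
          have h := square_shift (Wa := WN i 1) (w := 0) fb fc fd hya hxd hXd
            (by rw [hWN0 i 1 (by omega), mul_zero])
            (by rw [bot (i + 1) (by omega) (by omega)]; linarith)
          exact ⟨⟨hN.1, h.1⟩, fun _ => ⟨hN.2, h.2⟩⟩
        · have h := square_shift fb fc fd hya hxd hXd
            (hWN i j (by omega) (by omega)) (by linear_combination lc.2 hcor + ld.2 hcor)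
          exact ⟨⟨hN.1, h.1⟩, fun _ => ⟨hN.2, h.2⟩⟩
      -- On the left border `(i + 1, j)` is missing from `M_k`, and both `(i, j)` and `(i + 1, j +
      -- 1)` are marked, so `WN` and `XN` vanish there.
      · refine ⟨⟨?_, ?_⟩, fun h => by omega⟩
        · rw [hXN0 (i + 1) (j + 1) (by omega)]
          have h1 := lc.1
          have h2 := hW i j (by omega)
          rw [hXN0 i j (by omega), if_neg (by omega)] at h1
          rw [hW0 i (j - 1) (by omega), if_neg (by omega)] at h2
          rw [f0 (i + 1) j (by omega), zero_add] at hya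
          rw [h2]
          linear_combination h1 - W (i - 1) j * hya
        · have e := hx'' (i + 1) (j + 1) (by omega) (by omega) (by omega) (by omega) (by omega)
            (by omega) (by rw [Nat.add_sub_cancel, f0 (i + 1) j (by omega), inv_zero])
          rw [Nat.add_sub_cancel] at e
          rw [hWN0 i j (by omega), hX (i + 1) (j + 1) (by omega), Nat.add_sub_cancel,
            Nat.add_sub_cancel, hX0 (i + 1) j (by omega), if_neg (by omega)]
          linear_combination - X i (j + 1) * e
  -- the top row of the middle poset
  have top : ∀ v, k ≤ v → v ≤ r + k → X v (k + 1) - XN v (k + 1) =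
      W (v - 1) (k + 1) - WN (v - 1) (k + 1) := by
    intro v hv
    induction v, hv using Nat.le_induction with
    | base => intro _; rw [eqX _ _ le_rfl, eqW _ _ (by omega), sub_self, sub_self]
    | succ v hv ih =>
      intro h
      have h1 := ih (by omega)
      have h2 := (shift _ v k le_rfl hv hk le_rfl (by omega)).1
      have h3 := hW v (k + 1) (by omega)
      have h4 := hWN v (k + 1) (by omega) (by omega)
      have h5 := hy v (k + 1) (by omega) (by omega)
      rw [if_neg (by omega), Nat.add_sub_cancel, add_zero] at h3 h4
      rw [f0 v (k + 1 + 1) (by omega), add_zero] at h5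
      have fd := fpos (v + 1) (k + 1) (by omega)
      rw [Nat.add_sub_cancel]
      refine mul_right_cancel₀ fd.ne' ?_
      rw [h3, h4]
      -- The difference of the two shift identities contains `W - WN` at `(v, k)`; the induction
      -- hypothesis adds its value at `(v - 1, k + 1)`, and `h5` turns the sum into the value at
      -- `(v, k + 1)`.
      linear_combination h2.1 - h2.2 + f v (k + 1) * h1 -
        (W (v - 1) (k + 1) + W v k - WN (v - 1) (k + 1) - WN v k) * h5
  -- Above row `k + 1` there are no marks or minimal elements in this range, so both differences
  -- obey the same recurrence with labels shifted by one in `i`.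
  have above : ∀ n v j, v + j ≤ n → k ≤ v → k + 1 ≤ j → v ≤ r + k →
      X v j - XN v j = W (v - 1) j - WN (v - 1) j := by
    intro n
    induction n with
    | zero => intro v j; omega
    | succ n ih =>
      intro v j hn hv hj hvr
      rcases hj.eq_or_lt with rfl | hj
      · exact top v hv hvr
      by_cases h : k < v ∧ j ≤ s
      · have h1 := ih (v - 1) j (by omega) (by omega) (by omega) (by omega)
        have h2 := ih v (j - 1) (by omega) (by omega) (by omega) (by omega)
        have h3 := hB (v - 1) j (by omega) hj
        rw [Nat.sub_add_cancel (by omega)] at h3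
        rw [hX v j (by omega), hXN v j (by omega) (by omega), hW (v - 1) j (by omega),
          hWN (v - 1) j (by omega) (by omega), h3, if_neg (by omega), if_neg (by omega)]
        linear_combination x v j * (h1 + h2)
      · rw [hX0 v j (by omega), hXN0 v j (by omega), hW0 (v - 1) j (by omega),
          hWN0 (v - 1) j (by omega)]
  exact above _ (r + k) s le_rfl (by omega) hks le_rfl

/-! ### Chain sums as recurrences on the grid -/

section Grid

variable {S : Finset (ℕ × ℕ)}

/-- Extension by zero of a real function on a finite subset of the grid. -/
noncomputable def extend (g : S → ℝ) (i j : ℕ) : ℝ := if h : (i, j) ∈ S then g ⟨(i, j), h⟩ else 0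

theorem extend_of_mem (g : S → ℝ) {i j : ℕ} (h : (i, j) ∈ S) : extend g i j = g ⟨(i, j), h⟩ :=
  dif_pos h

theorem extend_of_notMem (g : S → ℝ) {i j : ℕ} (h : (i, j) ∉ S) : extend g i j = 0 :=
  dif_neg h

theorem sum_ite_eq_extend (g : S → ℝ) (i j : ℕ) :
    (∑ q : S, if (q : ℕ × ℕ) = (i, j) then g q else 0) = extend g i j := by
  by_cases h : (i, j) ∈ S
  · rw [extend_of_mem g h, Finset.sum_eq_single ⟨(i, j), h⟩ (fun q _ hq => if_neg fun h' =>
      hq (Subtype.ext h')) (by simp), if_pos rfl]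
  · rw [extend_of_notMem g h]
    exact Finset.sum_eq_zero fun q _ => if_neg fun (h' : (q : ℕ × ℕ) = (i, j)) => h (h' ▸ q.2)

open scoped Classical in
theorem sum_filter_eq_extend (g : S → ℝ) (m : S → Prop) {a b c d : ℕ} (hne : (a, b) ≠ (c, d))
    (hm : ∀ q : S, m q ↔ (q : ℕ × ℕ) = (a, b) ∨ (q : ℕ × ℕ) = (c, d)) :
    ∑ q with m q, g q = extend g a b + extend g c d := by
  rw [Finset.sum_filter, ← sum_ite_eq_extend, ← sum_ite_eq_extend, ← Finset.sum_add_distrib]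
  refine Finset.sum_congr rfl fun q _ => ?_
  by_cases h1 : (q : ℕ × ℕ) = (a, b)
  · simp [hm, h1, hne]
  · simp [hm, h1]

open scoped Classical in
-- By `hcov` every cover relation is a unit step, so at most two predecessors contribute. Missing
-- ones contribute zero, and the `1` at a minimal element counts the empty chain below it.
-- Positivity of the coordinates keeps truncated subtraction from returning the element itself.
theorem extend_chainSum (hS : ∀ p ∈ S, 1 ≤ p.1 ∧ 1 ≤ p.2)
    (hcov : ∀ p ∈ S, ∀ q ∈ S, q < p → ((p.1 - 1, p.2) ∈ S ∧ q ≤ (p.1 - 1, p.2)) ∨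
      ((p.1, p.2 - 1) ∈ S ∧ q ≤ (p.1, p.2 - 1)))
    (z : S → ℝ) {i j : ℕ} (h : (i, j) ∈ S) :
    extend (chainSum z) i j = z ⟨(i, j), h⟩ * (extend (chainSum z) (i - 1) j +
      extend (chainSum z) i (j - 1) + if IsMin (⟨(i, j), h⟩ : S) then 1 else 0) := by
  obtain ⟨hi, hj⟩ := hS _ h
  simp only at hi hj
  have l1 : ∀ h' : (i - 1, j) ∈ S, (⟨(i - 1, j), h'⟩ : S) < ⟨(i, j), h⟩ := fun h' => by
    rw [← Subtype.coe_lt_coe, Prod.lt_iff]; simp only; omega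
  have l2 : ∀ h' : (i, j - 1) ∈ S, (⟨(i, j - 1), h'⟩ : S) < ⟨(i, j), h⟩ := fun h' => by
    rw [← Subtype.coe_lt_coe, Prod.lt_iff]; simp only; omega
  rw [extend_of_mem _ h]
  split_ifs with hmin
  · rw [chainSum_of_isMin z hmin, extend_of_notMem _ fun h' => hmin.not_lt (l1 h'),
      extend_of_notMem _ fun h' => hmin.not_lt (l2 h')]
    ring
  · rw [chainSum_of_not_isMin z hmin, add_zero,
      sum_filter_eq_extend (chainSum z) (· ⋖ ⟨(i, j), h⟩) (a := i - 1) (b := j) (c := i)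
        (d := j - 1) (by simp; omega)]
    rintro ⟨q, hq⟩
    constructor
    · rintro ⟨hlt, hno⟩
      rcases hcov _ h q hq hlt with ⟨h1, h2⟩ | ⟨h1, h2⟩
      · left
        by_contra hne
        exact hno (c := ⟨_, h1⟩) (lt_of_le_of_ne h2 fun e => hne (congrArg Subtype.val e)) (l1 h1)
      · right
        by_contra hne
        exact hno (c := ⟨_, h1⟩) (lt_of_le_of_ne h2 fun e => hne (congrArg Subtype.val e)) (l2 h1)
    · rintro (rfl | rfl)
      · refine ⟨l1 hq, fun ⟨⟨a, b⟩, _⟩ h1 h2 => ?_⟩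
        rw [← Subtype.coe_lt_coe, Prod.lt_iff] at h1 h2
        simp only at h1 h2
        omega
      · refine ⟨l2 hq, fun ⟨⟨a, b⟩, _⟩ h1 h2 => ?_⟩
        rw [← Subtype.coe_lt_coe, Prod.lt_iff] at h1 h2
        simp only at h1 h2
        omega

theorem extend_chainSumFrom
    (hcov : ∀ p ∈ S, ∀ q ∈ S, p < q → ((p.1 + 1, p.2) ∈ S ∧ (p.1 + 1, p.2) ≤ q) ∨
      ((p.1, p.2 + 1) ∈ S ∧ (p.1, p.2 + 1) ≤ q))
    (z : S → ℝ) {i j : ℕ} (h : (i, j) ∈ S) (hmax : ¬ IsMax (⟨(i, j), h⟩ : S)) :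
    extend (chainSumFrom z) i j = z ⟨(i, j), h⟩ * (extend (chainSumFrom z) (i + 1) j +
      extend (chainSumFrom z) i (j + 1)) := by
  have l1 : ∀ h' : (i + 1, j) ∈ S, (⟨(i, j), h⟩ : S) < ⟨(i + 1, j), h'⟩ := fun h' => by
    rw [← Subtype.coe_lt_coe, Prod.lt_iff]; simp only; omega
  have l2 : ∀ h' : (i, j + 1) ∈ S, (⟨(i, j), h⟩ : S) < ⟨(i, j + 1), h'⟩ := fun h' => by
    rw [← Subtype.coe_lt_coe, Prod.lt_iff]; simp only; omega
  rw [extend_of_mem _ h, chainSumFrom_of_not_isMax z hmax,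
    sum_filter_eq_extend (chainSumFrom z) (⟨(i, j), h⟩ ⋖ ·) (a := i + 1) (b := j) (c := i)
      (d := j + 1) (by simp)]
  rintro ⟨q, hq⟩
  constructor
  · rintro ⟨hlt, hno⟩
    rcases hcov _ h q hq hlt with ⟨h1, h2⟩ | ⟨h1, h2⟩
    · left
      by_contra hne
      exact hno (c := ⟨_, h1⟩) (l1 h1) (lt_of_le_of_ne h2 fun e => hne (congrArg Subtype.val e).symm)
    · right
      by_contra hne
      exact hno (c := ⟨_, h1⟩) (l2 h1) (lt_of_le_of_ne h2 fun e => hne (congrArg Subtype.val e).symm)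
  · rintro (rfl | rfl)
    · refine ⟨l1 hq, fun ⟨⟨a, b⟩, _⟩ h1 h2 => ?_⟩
      rw [← Subtype.coe_lt_coe, Prod.lt_iff] at h1 h2
      simp only at h1 h2
      omega
    · refine ⟨l2 hq, fun ⟨⟨a, b⟩, _⟩ h1 h2 => ?_⟩
      rw [← Subtype.coe_lt_coe, Prod.lt_iff] at h1 h2
      simp only at h1 h2
      omega

end Grid

/-! ### Order structure of the middle and intermediate posets -/

section Posets

variable {r s k : ℕ}

theorem middle_pred (hks : k < s) (hsr : s ≤ r) : ∀ p ∈ middle r s k, ∀ q ∈ middle r s k, q < p →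
    ((p.1 - 1, p.2) ∈ middle r s k ∧ q ≤ (p.1 - 1, p.2)) ∨
      ((p.1, p.2 - 1) ∈ middle r s k ∧ q ≤ (p.1, p.2 - 1)) := by
  rintro ⟨i, j⟩ hp ⟨a, b⟩ hq hlt
  rw [Prod.lt_iff] at hlt
  simp only [mem_middle, Prod.mk_le_mk] at *
  omega

theorem middle_succ (hks : k < s) : ∀ p ∈ middle r s k, ∀ q ∈ middle r s k, p < q →
    ((p.1 + 1, p.2) ∈ middle r s k ∧ (p.1 + 1, p.2) ≤ q) ∨
      ((p.1, p.2 + 1) ∈ middle r s k ∧ (p.1, p.2 + 1) ≤ q) := by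
  rintro ⟨i, j⟩ hp ⟨a, b⟩ hq hlt
  rw [Prod.lt_iff] at hlt
  simp only [mem_middle, Prod.mk_le_mk] at *
  omega

theorem intermediate_pos : ∀ p ∈ intermediate r s k, 1 ≤ p.1 ∧ 1 ≤ p.2 := by
  rintro ⟨i, j⟩ hp
  simp only [mem_intermediate] at hp
  omega

theorem middle_pos : ∀ p ∈ middle r s k, 1 ≤ p.1 ∧ 1 ≤ p.2 := by
  rintro ⟨i, j⟩ hp
  simp only [mem_middle] at hp
  omega

/-- Although `I_k` is a union of two pieces, it has no cover relation longer than a unit step: a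
step in `i` is taken when it stays in `I_k` and above `q`, and otherwise a step in `j` is possible.
-/
theorem intermediate_pred (hk : 1 ≤ k) (hks : k ≤ s) (hsr : s ≤ r) :
    ∀ p ∈ intermediate r s k, ∀ q ∈ intermediate r s k, q < p →
      ((p.1 - 1, p.2) ∈ intermediate r s k ∧ q ≤ (p.1 - 1, p.2)) ∨
        ((p.1, p.2 - 1) ∈ intermediate r s k ∧ q ≤ (p.1, p.2 - 1)) := by
  rintro ⟨i, j⟩ hp ⟨a, b⟩ hq hlt
  by_cases h : a < i ∧ (i - 1, j) ∈ intermediate r s k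
  · rw [Prod.lt_iff] at hlt
    refine Or.inl ⟨h.2, ?_⟩
    rw [Prod.mk_le_mk]
    simp only at hlt
    omega
  · right
    rw [Prod.lt_iff] at hlt
    simp only [mem_intermediate, Prod.mk_le_mk] at *
    rcases hp with hp | hp <;> rcases hq with hq | hq <;> omega

theorem isMin_intermediate (hk : 1 ≤ k) (hks : k ≤ s) (hsr : s ≤ r) {i j : ℕ}
    (h : (i, j) ∈ intermediate r s k) :
    IsMin (⟨(i, j), h⟩ : intermediate r s k) ↔ i + j = k + 1 := by
  constructor
  · intro hmin
    by_contra hne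
    have : (i - 1, j) ∈ intermediate r s k ∨ (i, j - 1) ∈ intermediate r s k := by
      have h' := h
      simp only [mem_intermediate] at h' ⊢
      omega
    obtain ⟨hi, hj⟩ := intermediate_pos _ h
    simp only at hi hj
    rcases this with h' | h'
    · refine hmin.not_lt (b := ⟨_, h'⟩) ?_
      rw [← Subtype.coe_lt_coe, Prod.lt_iff]; simp only; omega
    · refine hmin.not_lt (b := ⟨_, h'⟩) ?_
      rw [← Subtype.coe_lt_coe, Prod.lt_iff]; simp only; omega
  · rintro hij ⟨⟨a, b⟩, h'⟩ hle
    rw [← Subtype.coe_le_coe, Prod.mk_le_mk] at *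
    simp only [mem_intermediate] at *
    omega

theorem top_mem_intermediate (hk : 1 ≤ k) (hks : k ≤ s) (hsr : s ≤ r) :
    (r + k - 1, s) ∈ intermediate r s k := by
  simp only [mem_intermediate]
  omega

theorem isTop_intermediate (hk : 1 ≤ k) (hks : k ≤ s) (hsr : s ≤ r) :
    IsTop (⟨_, top_mem_intermediate hk hks hsr⟩ : intermediate r s k) := by
  rintro ⟨⟨i, j⟩, h⟩
  rw [← Subtype.coe_le_coe, Prod.mk_le_mk]
  simp only [mem_intermediate] at h
  omega

theorem extend_chainSum_intermediate (hk : 1 ≤ k) (hks : k ≤ s) (hsr : s ≤ r)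
    (z : intermediate r s k → ℝ) {i j : ℕ} (h : (i, j) ∈ intermediate r s k) :
    extend (chainSum z) i j = z ⟨(i, j), h⟩ * (extend (chainSum z) (i - 1) j +
      extend (chainSum z) i (j - 1) + if i + j = k + 1 then 1 else 0) := by
  rw [extend_chainSum intermediate_pos (intermediate_pred hk hks hsr) z h]
  simp only [isMin_intermediate hk hks hsr h]

/-- Zeroing the labels of the elements that make a chain polygonal. -/
noncomputable def unmarked (x : Labeling (intermediate r s k)) (q : intermediate r s k) : ℝ :=
  if (q : ℕ × ℕ).1 + 1 = r + (q : ℕ × ℕ).2 ∨ (q : ℕ × ℕ) = (k, 1) then 0 else (x q : ℝ)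

/-- Zeroing the marked labels kills exactly the polygonal chains, so their weight is the difference
of two chain sums at the top. -/
theorem totalWeight_polygonalChains (hk : 1 ≤ k) (hks : k ≤ s) (hsr : s ≤ r)
    (x : Labeling (intermediate r s k)) :
    totalWeight x (polygonalChains r s k) =
      extend (chainSum fun q => (x q : ℝ)) (r + k - 1) s -
        extend (chainSum (unmarked x)) (r + k - 1) s := by
  classical
  rw [extend_of_mem _ (top_mem_intermediate hk hks hsr),
    extend_of_mem _ (top_mem_intermediate hk hks hsr)]
  have hmark : ∀ q : intermediate r s k,
      (q : ℕ × ℕ) ∈ leftBorder r s ↔ (q : ℕ × ℕ).1 + 1 = r + (q : ℕ × ℕ).2 := by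
    rintro ⟨⟨i, j⟩, h⟩
    simp only [leftBorder, Finset.mem_image, Finset.mem_Icc, Prod.mk.injEq]
    simp only [mem_intermediate] at h
    constructor
    · rintro ⟨l, hl, h1, h2⟩
      omega
    · intro h1
      exact ⟨j, by omega, by omega, rfl⟩
  have := totalWeight_meeting x (isTop_intermediate hk hks hsr) fun q : intermediate r s k =>
    (q : ℕ × ℕ).1 + 1 = r + (q : ℕ × ℕ).2 ∨ (q : ℕ × ℕ) = (k, 1)
  have hz : unmarked x = fun q : intermediate r s k => @ite ℝ ((q : ℕ × ℕ).1 + 1 =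
      r + (q : ℕ × ℕ).2 ∨ (q : ℕ × ℕ) = (k, 1)) (Classical.propDecidable _) 0 (x q : ℝ) := by
    funext q
    unfold unmarked
    congr
  rw [hz, ← this]
  congr 1
  ext C
  simp only [polygonalChains, Finset.mem_filter, hmark, and_or_left, exists_or]

end Posets

/-! ### One step and its iteration -/

/-- All the hypotheses of `chain_shift` are instances of the chain sum recurrences. The value of `a`
does not matter, because the relation for `x` is never needed at `(k, 1)`. -/
theorem totalWeight_zetaStep {r s k : ℕ} (hk : 1 ≤ k) (hks : k < s) (hsr : s ≤ r) (a : PosReal)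
    (x : Labeling (intermediate r s (k + 1))) :
    totalWeight x (polygonalChains r s (k + 1)) =
      totalWeight (zetaStep r s k hk hks a x) (polygonalChains r s k) := by
  classical
  set x' := zetaStep r s k hk hks a x with hx'
  set u := middleLabeling r s k a x with hu
  set v := (rowmotion (middle r s k))⁻¹ u with hv
  have huv : rowmotion (middle r s k) v = u := by simp [hv]
  set f : ℕ → ℕ → ℝ := extend (chainSumFrom fun q => (v q : ℝ)) with hf
  -- Rowmotion inverts chain sums inside `M_k`; outside, both sides are zero because `0⁻¹ = 0`.
  have hg : ∀ i j, extend (chainSum fun q => (u q : ℝ)) i j = (f i j)⁻¹ := by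
    intro i j
    by_cases h : (i, j) ∈ middle r s k
    · have hmul := chainSum_rowmotion_mul v ⟨(i, j), h⟩
      rw [huv] at hmul
      rw [hf, extend_of_mem _ h, extend_of_mem _ h]
      exact (inv_eq_of_mul_eq_one_left hmul).symm
    · rw [hf, extend_of_notMem _ h, extend_of_notMem _ h, inv_zero]
  have hlab : ∀ {k} (x : Labeling (intermediate r s k)) {i j} (h : (i, j) ∈ intermediate r s k),
      extend (fun q => (x q : ℝ)) i j = x ⟨(i, j), h⟩ := fun x _ _ h => extend_of_mem _ h
  rw [totalWeight_polygonalChains (by omega) (by omega) hsr,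
    totalWeight_polygonalChains hk (by omega) hsr, ← add_assoc, Nat.add_sub_cancel]
  refine chain_shift hk hks hsr (x := extend fun q => (x q : ℝ)) (y := extend fun q => (x' q : ℝ))
    (f := f) ?_ ?_ ?_ ?_ ?_ ?_ ?_ ?_ ?_ ?_ ?_ ?_ ?_ ?_
  · exact fun i j h => extend_of_notMem _ h
  · intro i j h
    rw [← inv_pos, ← hg, extend_of_mem _ h]
    exact chainSum_pos (fun q => (u q).2) _
  · intro i j h hne
    have hI : (i, j) ∈ intermediate r s k := by
      simp only [mem_middle, mem_intermediate, ne_eq, Prod.mk.injEq] at *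
      omega
    have htop : (r + k, k + 1) ∈ middle r s k := by
      simp only [mem_middle]
      omega
    have hmax : ¬ IsMax (⟨(i, j), h⟩ : middle r s k) := by
      refine not_isMax_iff.2 ⟨⟨_, htop⟩, lt_of_le_of_ne ?_ fun e => hne (congrArg Subtype.val e)⟩
      rw [← Subtype.coe_le_coe, Prod.mk_le_mk]
      simp only [mem_middle] at h
      omega
    rw [hf, extend_chainSumFrom (middle_succ hks) _ h hmax, hlab x' hI, hx', zetaStep, dif_pos h]
  · intro i j h hne
    have hI := middle_subset h hne
    have hbot : (k, 1) ∈ middle r s k := by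
      simp only [mem_middle]
      omega
    have hmin : ¬ IsMin (⟨(i, j), h⟩ : middle r s k) := by
      refine not_isMin_iff.2 ⟨⟨_, hbot⟩, lt_of_le_of_ne ?_ fun e => hne (congrArg Subtype.val e).symm⟩
      rw [← Subtype.coe_le_coe, Prod.mk_le_mk]
      simp only [mem_middle] at h
      omega
    have := extend_chainSum middle_pos (middle_pred hks hsr) (fun q => (u q : ℝ)) h
    rw [hg, hg, hg, if_neg hmin, add_zero] at this
    rw [this, hlab x hI, hu, middleLabeling, dif_neg hne]
  · exact fun i j h => extend_of_notMem _ h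
  · intro i j h
    rw [hlab x h]
    exact extend_chainSum_intermediate (by omega) hks hsr _ h
  · intro i j h
    by_cases hI : (i, j) ∈ intermediate r s (k + 1)
    · rw [extend_chainSum_intermediate (by omega) hks hsr _ hI, unmarked,
        if_pos (h.resolve_left (not_not.2 hI)), zero_mul]
    · exact extend_of_notMem _ hI
  · intro i j h hm
    rw [extend_chainSum_intermediate (by omega) hks hsr _ h, hlab x h, unmarked, if_neg hm]
  · exact fun i j h => extend_of_notMem _ h
  · intro i j h
    rw [hlab x' h]
    exact extend_chainSum_intermediate hk hks.le hsr _ h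
  · intro i j h
    by_cases hI : (i, j) ∈ intermediate r s k
    · rw [extend_chainSum_intermediate hk hks.le hsr _ hI, unmarked,
        if_pos (h.resolve_left (not_not.2 hI)), zero_mul]
    · exact extend_of_notMem _ hI
  · intro i j h hm
    rw [extend_chainSum_intermediate hk hks.le hsr _ h, hlab x' h, unmarked, if_neg hm]
  · intro i j h hi
    have hM : (i, j) ∉ middle r s k := by
      simp only [mem_middle]
      omega
    have hj : ¬ k + 1 < j := by
      simp only [mem_intermediate] at h
      omega
    rw [hlab x' h, hlab x (below_mem hk hks h hM hj).2, hx', zetaStep, dif_neg hM, dif_neg hj]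
  · intro i j h hj
    have hM : (i, j) ∉ middle r s k := by
      simp only [mem_middle]
      omega
    rw [hlab x' h, hlab x (above_mem h hj), hx', zetaStep, dif_neg hM, dif_pos hj]

theorem totalWeight_zetaComp {r s : ℕ} (hsr : s ≤ r) (a : ℕ → PosReal) (m : ℕ) (hm : m < s)
    (x : Labeling (intermediate r s (m + 1))) :
    totalWeight x (polygonalChains r s (m + 1)) =
      totalWeight (zetaComp r s a m hm x) (polygonalChains r s 1) := by
  induction m with
  | zero => rfl
  | succ m ih =>
    rw [totalWeight_zetaStep (Nat.le_add_left 1 m) hm hsr (a (m + 1)) x, ih (Nat.lt_of_succ_lt hm)]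
    rfl

theorem totalWeight_restrict {S S' : Finset (ℕ × ℕ)} (h : S = S') (x : Labeling S) :
    totalWeight (x.restrict h.ge) (maxChains S') = totalWeight x (maxChains S) := by
  subst h
  rfl

theorem mem_of_isTop {P : Type} [Fintype P] [PartialOrder P] {C : Finset P} (hC : C ∈ maxChains P)
    {t : P} (ht : IsTop t) : t ∈ C :=
  (mem_maxChains.1 hC).2 t fun c _ => Or.inl (ht c)

/-- The top `(r + s - 1, s)` belongs to every maximal chain and to the left border. -/
theorem polygonalChains_self {r s : ℕ} (hs : 1 ≤ s) (hsr : s ≤ r) :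
    polygonalChains r s s = maxChains (intermediate r s s) := by
  refine Finset.filter_true_of_mem fun C hC => Or.inl ⟨_, mem_of_isTop hC
    (isTop_intermediate hs le_rfl hsr), Finset.mem_image.2 ⟨s, by simp [hs], ?_⟩⟩
  rw [add_comm]

/-- For `k = 1` the marked element `(k, 1)` is the bottom, which belongs to every maximal chain. -/
theorem polygonalChains_one {r s : ℕ} (hs : 1 ≤ s) (hsr : s ≤ r) :
    polygonalChains r s 1 = maxChains (intermediate r s 1) := by
  have hb : (1, 1) ∈ intermediate r s 1 := by
    simp only [mem_intermediate]
    omega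
  refine Finset.filter_true_of_mem fun C hC => Or.inr ⟨⟨_, hb⟩,
    (mem_maxChains.1 hC).2 _ fun c _ => Or.inr (intermediate_pos _ c.2), rfl⟩

end RectTrap

theorem mainTheorem4 (r s : ℕ) (hs : 1 ≤ s) (hsr : s ≤ r) (a : ℕ → RectTrap.PosReal) :
    (∀ x : RectTrap.Labeling (RectTrap.trapezoid r s),
      RectTrap.totalWeight x (RectTrap.maxChains (RectTrap.trapezoid r s)) =
        RectTrap.totalWeight (RectTrap.zeta r s hs a x)
          (RectTrap.maxChains (RectTrap.rectangle r s))) ∧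
    (∀ (k : ℕ) (hk : 1 ≤ k) (hks : k < s)
      (x : RectTrap.Labeling (RectTrap.intermediate r s (k + 1))),
      RectTrap.totalWeight x (RectTrap.polygonalChains r s (k + 1)) =
        RectTrap.totalWeight (RectTrap.zetaStep r s k hk hks (a k) x)
          (RectTrap.polygonalChains r s k)) := by
  refine ⟨fun x => ?_, fun k hk hks x => RectTrap.totalWeight_zetaStep hk hks hsr (a k) x⟩
  have hS : RectTrap.trapezoid r s = RectTrap.intermediate r s (s - 1 + 1) := by
    rw [Nat.sub_add_cancel hs, RectTrap.trapezoid_eq]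
  rw [RectTrap.zeta, RectTrap.totalWeight_restrict (RectTrap.rectangle_eq r s hs),
    ← RectTrap.polygonalChains_one hs hsr, ← RectTrap.totalWeight_zetaComp hsr]
  have hP : RectTrap.polygonalChains r s (s - 1 + 1) =
      RectTrap.maxChains (RectTrap.intermediate r s (s - 1 + 1)) := by
    rw [Nat.sub_add_cancel hs]
    exact RectTrap.polygonalChains_self hs hsr
  rw [hP, RectTrap.totalWeight_restrict hS]
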